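/- For an algebraic number $\alpha\in\mathbb{C}$, let $H(\alpha)$ denote its height, i.e. the maximum of the absolute values of the coefficients of its minimal polynomial with coprime integer coefficients. For a positive integer $n$ and $\xi\in\mathbb{C}$, let $w_n^*(\xi)$ denote the supremum of the real numbers $w^*$ for which $$0<|\xi-\alpha|\le H(\alpha)^{-w^*-1}$$ is satisfied by infinitely many algebraic numbers $\alpha\in\mathbb{C}$ of degree at most $n$. **Proposition 10.2.** Let $n$ be a positive integer and let $\xi\in\mathbb{C}$ (real or non-real) be an algebraic number of degree $n+1$. Then $w_n^*(\xi)$ is finite, and there exist a constant $c(\xi)>0$ and infinitely many algebraic numbers $\alpha\in\mathbb{C}$ of degree at most $n$ such that $$0<|\xi-\alpha|\le c(\xi)\,H(\alpha)^{-w_n^*(\xi)-1}.$$ -/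

import Mathlib

open Polynomial

/-- The minimal polynomial, with coprime integer coefficients, of an algebraic number `α`:
clear the denominators of the monic minimal polynomial over `ℚ` and divide by the content.
(It is determined up to sign, which does not affect the height.) -/
noncomputable def intMinpoly (α : ℂ) : ℤ[X] :=
  (IsLocalization.integerNormalization (nonZeroDivisors ℤ) (minpoly ℚ α)).primPart

/-- The integer minimal polynomial has coprime coefficients. -/
theorem intMinpoly_isPrimitive (α : ℂ) : (intMinpoly α).IsPrimitive :=
  Polynomial.isPrimitive_primPart _

/-- The integer minimal polynomial of an algebraic number is a nonzero rational multiple of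
its monic minimal polynomial over `ℚ`. -/
theorem intMinpoly_map (α : ℂ) (hα : IsAlgebraic ℚ α) :
    ∃ q : ℚ, q ≠ 0 ∧ (intMinpoly α).map (Int.castRingHom ℚ) = C q * minpoly ℚ α := by
  obtain ⟨b, hb, h⟩ := IsLocalization.integerNormalization_spec
    (nonZeroDivisors ℤ) (minpoly ℚ α)
  have hm : minpoly ℚ α ≠ 0 := minpoly.ne_zero hα.isIntegral
  have hb0 : (b : ℚ) ≠ 0 := by exact_mod_cast nonZeroDivisors.ne_zero hb
  set N := IsLocalization.integerNormalization (nonZeroDivisors ℤ) (minpoly ℚ α) with hN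
  have h' : N.map (Int.castRingHom ℚ) = C (b : ℚ) * minpoly ℚ α := by
    have : N.map (algebraMap ℤ ℚ) = b • minpoly ℚ α := h
    rw [← algebraMap_int_eq, this, ← Polynomial.smul_eq_C_mul, Int.cast_smul_eq_zsmul]
  have hN0 : N ≠ 0 := by
    intro h0
    rw [h0, Polynomial.map_zero] at h'
    exact mul_ne_zero (C_ne_zero.mpr hb0) hm h'.symm
  have hc : (N.content : ℚ) ≠ 0 := by
    exact_mod_cast fun h0 => hN0 (Polynomial.content_eq_zero_iff.mp h0)
  refine ⟨(N.content : ℚ)⁻¹ * b, mul_ne_zero (inv_ne_zero hc) hb0, ?_⟩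
  rw [C_mul, mul_assoc, ← h']
  have hp : N.map (Int.castRingHom ℚ) =
      C (N.content : ℚ) * N.primPart.map (Int.castRingHom ℚ) := by
    conv_lhs => rw [N.eq_C_content_mul_primPart]
    rw [Polynomial.map_mul, Polynomial.map_C, eq_intCast]
  rw [hp, ← mul_assoc, ← C_mul, inv_mul_cancel₀ hc, C_1, one_mul, intMinpoly, ← hN]

/-- The height of an algebraic number: the maximum of the absolute values of the coefficients
of its integer minimal polynomial. -/
noncomputable def algHeight (α : ℂ) : ℝ :=
  (intMinpoly α).supNorm

/-- The complex algebraic numbers of degree at most `n`. -/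
def algNumbersOfDegreeLE (n : ℕ) : Set ℂ :=
  {α : ℂ | IsAlgebraic ℚ α ∧ (minpoly ℚ α).natDegree ≤ n}

/-- Koksma's exponent `w_n^*(ξ)`: the supremum (in the extended reals, as it may be infinite
for transcendental `ξ`) of the real numbers `w` such that `0 < |ξ - α| ≤ H(α) ^ (-w - 1)` holds
for infinitely many algebraic numbers `α` of degree at most `n`. -/
noncomputable def koksmaExponent (n : ℕ) (ξ : ℂ) : EReal :=
  ⨆ w ∈ {w : ℝ | {α ∈ algNumbersOfDegreeLE n |
    0 < ‖ξ - α‖ ∧ ‖ξ - α‖ ≤ algHeight α ^ (-w - 1)}.Infinite}, (w : EReal)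

open Polynomial

/-! Let e be 1 for real ξ and 2 otherwise, the size of {ξ, conj ξ}. If e ≤ n, the exponent is
(n+1)/e - 1.

Upper bound, `exists_le_norm_sub_pow_mul_algHeight_pow`: if P is the integer minimal polynomial of
α, the norm of P(ξ) is bounded below by a resultant. The e factors at ξ and conj ξ are ≪ H(α)|ξ-α|,
the others ≪ H(α), so |ξ-α|^e H(α)^(n+1) ≫ 1.

Lower bound, `exists_close_algebraic`: Dirichlet gives P with coefficients at most q^e and |P(ξ)| ≪
q^(e-n-1). The norm bound then forces |P(s)| ≫ q^e at a conjugate s outside the pair. P'(ξ) may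
still be small, so P is replaced by a reduction Q_j of b X^j P modulo the minimal polynomial of ξ;
Lagrange interpolation at the conjugates shows that some |Q_j'(ξ)| ≫ |P(s)|. Hence Q_j has a root α
with |ξ-α| ≪ q^(-n-1) and H(α) ≪ q^e.

If e > n, then n = 1 and ξ is non-real: rationals stay at distance at least |Im ξ| and the exponent
is -1. -/

/-! ### Integer minimal polynomials, heights and Northcott finiteness. -/

theorem intMinpoly_ne_zero (α : ℂ) : intMinpoly α ≠ 0 :=
  (intMinpoly_isPrimitive α).ne_zero

theorem natDegree_intMinpoly {α : ℂ} (hα : IsAlgebraic ℚ α) :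
    (intMinpoly α).natDegree = (minpoly ℚ α).natDegree := by
  obtain ⟨q, hq, h⟩ := intMinpoly_map α hα
  rw [← natDegree_map_eq_of_injective (Int.castRingHom ℚ).injective_int, h, natDegree_C_mul hq]

theorem exists_map_intMinpoly {α : ℂ} (hα : IsAlgebraic ℚ α) :
    ∃ q : ℂ, q ≠ 0 ∧ (intMinpoly α).map (Int.castRingHom ℂ) =
      C q * (minpoly ℚ α).map (algebraMap ℚ ℂ) := by
  obtain ⟨q, hq, h⟩ := intMinpoly_map α hα
  refine ⟨algebraMap ℚ ℂ q, by simpa using hq, ?_⟩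
  rw [← map_C, ← Polynomial.map_mul, ← h, Polynomial.map_map]
  congr 1

theorem aeval_intMinpoly_eq_zero_iff {α : ℂ} (hα : IsAlgebraic ℚ α) (z : ℂ) :
    aeval z (intMinpoly α) = 0 ↔ aeval z (minpoly ℚ α) = 0 := by
  obtain ⟨q, hq, h⟩ := exists_map_intMinpoly hα
  have h' := congrArg (eval z) h
  rw [eval_mul, eval_C, eval_map_algebraMap, ← algebraMap_int_eq, eval_map_algebraMap] at h'
  rw [h', mul_eq_zero, or_iff_right hq]

theorem aeval_intMinpoly {α : ℂ} (hα : IsAlgebraic ℚ α) : aeval α (intMinpoly α) = 0 :=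
  (aeval_intMinpoly_eq_zero_iff hα α).mpr (minpoly.aeval ℚ α)

theorem one_le_algHeight (α : ℂ) : 1 ≤ algHeight α := by
  refine le_trans ?_ ((intMinpoly α).le_supNorm (intMinpoly α).natDegree)
  rw [Int.norm_eq_abs]
  exact_mod_cast Int.one_le_abs (leadingCoeff_ne_zero.mpr (intMinpoly_ne_zero α))

theorem supNorm_map_intCast (P : ℤ[X]) : (P.map (Int.castRingHom ℂ)).supNorm = P.supNorm := by
  rw [supNorm_eq_iSup, supNorm_eq_iSup]
  simp [Int.norm_eq_abs]

theorem aeval_map_intCast_rat (P : ℤ[X]) (z : ℂ) :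
    aeval z (P.map (Int.castRingHom ℚ)) = aeval z P := by
  rw [← algebraMap_int_eq, aeval_map_algebraMap]

theorem isAlgebraic_of_aeval_int {P : ℤ[X]} (hP : P ≠ 0) {z : ℂ} (hz : aeval z P = 0) :
    IsAlgebraic ℚ z :=
  ⟨P.map (Int.castRingHom ℚ),
    (Polynomial.map_ne_zero_iff (Int.castRingHom ℚ).injective_int).mpr hP,
    by rwa [aeval_map_intCast_rat]⟩

theorem intMinpoly_dvd {P : ℤ[X]} {α : ℂ} (hα : IsAlgebraic ℚ α) (hz : aeval α P = 0) :
    intMinpoly α ∣ P := by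
  rw [IsPrimitive.Int.dvd_iff_map_cast_dvd_map_cast _ _ (intMinpoly_isPrimitive α)]
  obtain ⟨q, hq, h⟩ := intMinpoly_map α hα
  rw [h, (isUnit_C.mpr hq.isUnit).mul_left_dvd]
  exact minpoly.dvd _ _ (by rwa [aeval_map_intCast_rat])

/-- The Mahler measure is multiplicative and at least 1 on the integer cofactor, so the measure of P
controls the coefficients of its divisor `intMinpoly α`. -/
theorem algHeight_le_of_root {n : ℕ} {P : ℤ[X]} (hP : P ≠ 0) (hn : P.natDegree ≤ n) {α : ℂ}
    (hz : aeval α P = 0) :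
    α ∈ algNumbersOfDegreeLE n ∧ algHeight α ≤ 2 ^ n * (n + 1) * P.supNorm := by
  have hα := isAlgebraic_of_aeval_int hP hz
  obtain ⟨h, rfl⟩ := intMinpoly_dvd hα hz
  have hh : h ≠ 0 := right_ne_zero_of_mul hP
  have hdeg : (intMinpoly α).natDegree ≤ n :=
    (natDegree_le_of_dvd (Dvd.intro _ rfl) hP).trans hn
  refine ⟨⟨hα, natDegree_intMinpoly hα ▸ hdeg⟩, ?_⟩
  have hM := mahlerMeasure_le_sqrt_natDegree_add_one_mul_supNorm
    ((intMinpoly α * h).map (Int.castRingHom ℂ))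
  rw [supNorm_map_intCast, natDegree_map_eq_of_injective (Int.castRingHom ℂ).injective_int] at hM
  have hs : √(((intMinpoly α * h).natDegree : ℝ) + 1) ≤ n + 1 := by
    refine (Real.sqrt_le_left (by positivity)).mpr ?_
    have : ((intMinpoly α * h).natDegree : ℝ) ≤ n := by exact_mod_cast hn
    nlinarith [(Nat.cast_nonneg n : (0 : ℝ) ≤ n)]
  obtain ⟨i, hi⟩ := (intMinpoly α).exists_eq_supNorm
  rw [algHeight, hi]
  have hc := norm_coeff_le_choose_mul_mahlerMeasure_of_one_le_mahlerMeasure i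
    ((intMinpoly α).map (Int.castRingHom ℂ)) (h.map (Int.castRingHom ℂ))
    (one_le_mahlerMeasure_of_ne_zero hh)
  rw [← Polynomial.map_mul, natDegree_map_eq_of_injective (Int.castRingHom ℂ).injective_int] at hc
  have hc' : ‖(intMinpoly α).coeff i‖ = ‖((intMinpoly α).map (Int.castRingHom ℂ)).coeff i‖ := by
    simp [Int.norm_eq_abs]
  rw [hc']
  have hch : (((intMinpoly α).natDegree.choose i : ℕ) : ℝ) ≤ 2 ^ n := by
    have := (Nat.choose_le_two_pow (intMinpoly α).natDegree i).trans
      (Nat.pow_le_pow_right two_pos hdeg)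
    exact_mod_cast this
  calc _ ≤ _ := hc
    _ ≤ 2 ^ n * ((n + 1) * (intMinpoly α * h).supNorm) :=
      mul_le_mul hch (hM.trans (mul_le_mul_of_nonneg_right hs (supNorm_nonneg _)))
        (mahlerMeasure_nonneg _) (by positivity)
    _ = _ := by ring

/-- Northcott's theorem for the naive height. -/
theorem finite_algHeight_le (n : ℕ) (B : ℝ) :
    {α ∈ algNumbersOfDegreeLE n | algHeight α ≤ B}.Finite := by
  have hfin := finite_mahlerMeasure_le n (Real.toNNReal ((n + 1) * B))
  refine (hfin.biUnion (t := fun p => {z : ℂ | z ∈ (p.aroots ℂ).toFinset})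
    fun p _ => (p.aroots ℂ).toFinset.finite_toSet).subset ?_
  rintro α ⟨⟨hα, hdeg⟩, hB⟩
  simp only [Set.mem_iUnion]
  have hd : (intMinpoly α).natDegree ≤ n := natDegree_intMinpoly hα ▸ hdeg
  refine ⟨intMinpoly α, ⟨hd, ?_⟩, ?_⟩
  · refine (mahlerMeasure_le_sqrt_natDegree_add_one_mul_supNorm _).trans ?_
    rw [supNorm_map_intCast, natDegree_map_eq_of_injective (Int.castRingHom ℂ).injective_int]
    have hs : √(((intMinpoly α).natDegree : ℝ) + 1) ≤ n + 1 := by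
      refine (Real.sqrt_le_left (by positivity)).mpr ?_
      have : ((intMinpoly α).natDegree : ℝ) ≤ n := by exact_mod_cast hd
      nlinarith [(Nat.cast_nonneg n : (0 : ℝ) ≤ n)]
    exact (mul_le_mul hs hB (supNorm_nonneg _) (by positivity)).trans (Real.le_coe_toNNReal _)
  · rw [Set.mem_ofPred_eq, Multiset.mem_toFinset, mem_aroots]
    exact ⟨intMinpoly_ne_zero α, aeval_intMinpoly hα⟩

/-! ### Upper bounds for values of integer polynomials. -/

theorem norm_aeval_le_of_natDegree_le {n : ℕ} {P : ℤ[X]} (hn : P.natDegree ≤ n) (z : ℂ) :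
    ‖aeval z P‖ ≤ P.supNorm * ∑ i ∈ Finset.range (n + 1), ‖z‖ ^ i := by
  rw [aeval_eq_sum_range' (Nat.lt_succ_of_le hn), Finset.mul_sum]
  refine norm_sum_le_of_le _ fun i _ => ?_
  rw [norm_smul, norm_pow]
  gcongr
  exact P.le_supNorm i

/-- Write P(ξ) = P(ξ) - P(α) and take the factor ξ - α out of each difference of monomials. -/
theorem norm_aeval_le_mul_of_root (n : ℕ) (ξ : ℂ) :
    ∃ K : ℝ, 0 < K ∧ ∀ (P : ℤ[X]) (α : ℂ), P.natDegree ≤ n → aeval α P = 0 → ‖ξ - α‖ ≤ 1 →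
      ‖aeval ξ P‖ ≤ K * P.supNorm * ‖ξ - α‖ := by
  -- The final `+ 1` keeps the constant positive when n = 0.
  refine ⟨(n + 1) * (n * (‖ξ‖ + 1) ^ n) + 1, by positivity, fun P α hn hz h1 => ?_⟩
  have hα : ‖α‖ ≤ ‖ξ‖ + 1 := by
    have := norm_sub_norm_le α ξ
    rw [norm_sub_rev] at this
    linarith
  have hb : (1 : ℝ) ≤ ‖ξ‖ + 1 := by linarith [norm_nonneg ξ]
  have hpow : ∀ i ∈ Finset.range (n + 1), ‖ξ ^ i - α ^ i‖ ≤ n * (‖ξ‖ + 1) ^ n * ‖ξ - α‖ := by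
    intro i hi
    have hi' : i ≤ n := Nat.lt_succ_iff.mp (Finset.mem_range.mp hi)
    rw [← (Commute.all ξ α).geom_sum₂_mul, norm_mul]
    gcongr
    refine (norm_sum_le_of_le (f := fun k => ξ ^ k * α ^ (i - 1 - k)) (Finset.range i)
      (n := fun _ => (‖ξ‖ + 1) ^ n) fun k hk => ?_).trans ?_
    · rw [norm_mul, norm_pow, norm_pow]
      have hk' := Finset.mem_range.mp hk
      calc ‖ξ‖ ^ k * ‖α‖ ^ (i - 1 - k) ≤ (‖ξ‖ + 1) ^ k * (‖ξ‖ + 1) ^ (i - 1 - k) := by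
            gcongr; linarith
        _ = (‖ξ‖ + 1) ^ (k + (i - 1 - k)) := (pow_add _ _ _).symm
        _ ≤ _ := pow_le_pow_right₀ hb (by omega)
    · rw [Finset.sum_const, Finset.card_range, nsmul_eq_mul]
      gcongr
  have heq : aeval ξ P = ∑ i ∈ Finset.range (n + 1), P.coeff i • (ξ ^ i - α ^ i) := by
    simp_rw [smul_sub, Finset.sum_sub_distrib]
    rw [← aeval_eq_sum_range' (Nat.lt_succ_of_le hn), ← aeval_eq_sum_range' (Nat.lt_succ_of_le hn),
      hz, sub_zero]
  have hle : ‖aeval ξ P‖ ≤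
      ∑ i ∈ Finset.range (n + 1), P.supNorm * (n * (‖ξ‖ + 1) ^ n * ‖ξ - α‖) := by
    rw [heq]
    refine norm_sum_le_of_le _ fun i hi => ?_
    rw [norm_smul]
    exact mul_le_mul (P.le_supNorm i) (hpow i hi) (norm_nonneg _) (supNorm_nonneg _)
  rw [Finset.sum_const, Finset.card_range, nsmul_eq_mul] at hle
  push_cast at hle
  nlinarith [mul_nonneg (supNorm_nonneg P) (norm_nonneg (ξ - α))]

/-! ### Conjugates and the lower bound for norms. -/

/-- The conjugates over `ℚ` of an algebraic number. -/
noncomputable def conjugates (ξ : ℂ) : Finset ℂ := ((minpoly ℚ ξ).aroots ℂ).toFinset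

theorem mem_conjugates {ξ : ℂ} (hξ : IsAlgebraic ℚ ξ) {r : ℂ} :
    r ∈ conjugates ξ ↔ aeval r (minpoly ℚ ξ) = 0 := by
  rw [conjugates, Multiset.mem_toFinset, mem_aroots,
    and_iff_right (minpoly.ne_zero hξ.isIntegral)]

theorem nodup_aroots_minpoly {ξ : ℂ} (hξ : IsAlgebraic ℚ ξ) :
    ((minpoly ℚ ξ).aroots ℂ).Nodup :=
  nodup_roots (minpoly.irreducible hξ.isIntegral).separable.map

theorem card_conjugates {ξ : ℂ} (hξ : IsAlgebraic ℚ ξ) :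
    (conjugates ξ).card = (minpoly ℚ ξ).natDegree := by
  rw [conjugates, Multiset.toFinset_card_of_nodup (nodup_aroots_minpoly hξ), aroots,
    ← (IsAlgClosed.splits _).natDegree_eq_card_roots, natDegree_map]

theorem minpoly_eq_of_mem_conjugates {ξ r : ℂ} (hξ : IsAlgebraic ℚ ξ) (hr : r ∈ conjugates ξ) :
    minpoly ℚ ξ = minpoly ℚ r :=
  minpoly.eq_of_irreducible_of_monic (minpoly.irreducible hξ.isIntegral)
    ((mem_conjugates hξ).mp hr) (minpoly.monic hξ.isIntegral)

theorem aeval_conjugate_eq_zero {ξ r : ℂ} (hξ : IsAlgebraic ℚ ξ) (hr : r ∈ conjugates ξ)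
    {P : ℤ[X]} (h : aeval r P = 0) : aeval ξ P = 0 := by
  rw [← aeval_map_intCast_rat] at h ⊢
  have := minpoly.dvd ℚ r h
  rw [← minpoly_eq_of_mem_conjugates hξ hr] at this
  exact aeval_eq_zero_of_dvd_aeval_eq_zero this (minpoly.aeval ℚ ξ)

theorem aeval_ne_zero_of_natDegree_lt {ξ : ℂ} {P : ℤ[X]} (hP : P ≠ 0)
    (h : P.natDegree < (minpoly ℚ ξ).natDegree) : aeval ξ P ≠ 0 := by
  intro h0
  rw [← aeval_map_intCast_rat] at h0
  have hP' : P.map (Int.castRingHom ℚ) ≠ 0 :=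
    (Polynomial.map_ne_zero_iff (Int.castRingHom ℚ).injective_int).mpr hP
  have := natDegree_le_of_dvd (minpoly.dvd ℚ ξ h0) hP'
  have := natDegree_map_le (f := Int.castRingHom ℚ) (p := P)
  omega

/-- The norm of a nonzero algebraic number `P(ξ)` is bounded from below. -/
theorem exists_le_prod_norm_aeval_conjugates {ξ : ℂ} (hξ : IsAlgebraic ℚ ξ) (n : ℕ) :
    ∃ c : ℝ, 0 < c ∧ ∀ P : ℤ[X], P.natDegree ≤ n → aeval ξ P ≠ 0 →
      c ≤ ∏ r ∈ conjugates ξ, ‖aeval r P‖ := by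
  set f := intMinpoly ξ with hf
  set F := f.map (Int.castRingHom ℂ) with hF
  have hF0 : F ≠ 0 := (Polynomial.map_ne_zero_iff (Int.castRingHom ℂ).injective_int).mpr
    (intMinpoly_ne_zero ξ)
  have hlc : 0 < ‖F.leadingCoeff ^ n‖ := norm_pos_iff.mpr (pow_ne_zero _ (leadingCoeff_ne_zero.mpr hF0))
  refine ⟨‖F.leadingCoeff ^ n‖⁻¹, inv_pos.mpr hlc, fun P hP h0 => ?_⟩
  have hroots : F.roots = (conjugates ξ).val := by
    obtain ⟨q, hq, h⟩ := exists_map_intMinpoly hξ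
    rw [hF, h, roots_C_mul _ hq, conjugates, Multiset.toFinset_val,
      (nodup_aroots_minpoly hξ).dedup]
  -- Formal degree n, instead of the degree of P, makes the power of the leading coefficient
  -- independent of P. The resultant is a nonzero integer, hence at least 1 in absolute value.
  have hres := resultant_eq_prod_eval F (P.map (Int.castRingHom ℂ)) n
    (natDegree_map_le.trans hP) (IsAlgClosed.splits _)
  rw [hroots, resultant_map_map] at hres
  have hprod : ((conjugates ξ).val.map (eval · (P.map (Int.castRingHom ℂ)))).prod =
      ∏ r ∈ conjugates ξ, aeval r P := by
    refine Finset.prod_congr rfl fun r _ => ?_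
    rw [← algebraMap_int_eq, eval_map_algebraMap]
  rw [hprod] at hres
  have hne : ∏ r ∈ conjugates ξ, aeval r P ≠ 0 :=
    Finset.prod_ne_zero_iff.mpr fun r hr h => h0 (aeval_conjugate_eq_zero hξ hr h)
  have hn := congrArg norm hres
  rw [norm_mul, norm_prod] at hn
  have hz : resultant f P F.natDegree n ≠ 0 := by
    intro hz
    rw [hz, map_zero] at hres
    exact mul_ne_zero (norm_pos_iff.mp hlc) hne hres.symm
  have h1 : 1 ≤ ‖Int.castRingHom ℂ (resultant f P F.natDegree n)‖ := by
    rw [eq_intCast, Complex.norm_intCast]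
    exact_mod_cast Int.one_le_abs hz
  rw [inv_le_iff_one_le_mul₀ hlc, mul_comm, ← hn]
  exact h1

/-! ### The pair ξ, conj ξ and Liouville's inequality. -/

/-- A complex number together with its complex conjugate. -/
noncomputable def conjPair (ξ : ℂ) : Finset ℂ := {ξ, starRingEnd ℂ ξ}

theorem aeval_conj_int (P : ℤ[X]) (z : ℂ) :
    aeval (starRingEnd ℂ z) P = starRingEnd ℂ (aeval z P) :=
  aeval_algHom_apply (starRingEnd ℂ).toIntAlgHom z P

/-- The pair is a singleton for real ξ, so the exponent 1 or 2 treats both cases at once. -/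
theorem prod_conjPair_norm_aeval (ξ : ℂ) (P : ℤ[X]) :
    ∏ r ∈ conjPair ξ, ‖aeval r P‖ = ‖aeval ξ P‖ ^ (conjPair ξ).card := by
  refine Finset.prod_eq_pow_card fun r hr => ?_
  rw [conjPair, Finset.mem_insert, Finset.mem_singleton] at hr
  rcases hr with rfl | rfl
  · rfl
  · rw [aeval_conj_int, Complex.norm_conj]

theorem conjPair_subset_conjugates {ξ : ℂ} (hξ : IsAlgebraic ℚ ξ) :
    conjPair ξ ⊆ conjugates ξ := by
  intro r hr
  rw [conjPair, Finset.mem_insert, Finset.mem_singleton] at hr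
  rw [mem_conjugates hξ]
  rcases hr with rfl | rfl
  · exact minpoly.aeval ℚ r
  · refine (aeval_algHom_apply (starRingEnd ℂ).toRatAlgHom ξ _).trans ?_
    rw [minpoly.aeval, map_zero]

theorem self_mem_conjPair (ξ : ℂ) : ξ ∈ conjPair ξ := Finset.mem_insert_self _ _

theorem card_conjPair_pos (ξ : ℂ) : 0 < (conjPair ξ).card :=
  Finset.card_pos.mpr ⟨ξ, self_mem_conjPair ξ⟩

theorem exists_norm_aeval_conjugates_le (ξ : ℂ) (n : ℕ) :
    ∃ B : ℝ, 0 < B ∧ ∀ P : ℤ[X], P.natDegree ≤ n → ∀ r ∈ conjugates ξ,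
      ‖aeval r P‖ ≤ B * P.supNorm := by
  have hnn : ∀ r : ℂ, 0 ≤ ∑ i ∈ Finset.range (n + 1), ‖r‖ ^ i := fun r => by positivity
  refine ⟨(∑ r ∈ conjugates ξ, ∑ i ∈ Finset.range (n + 1), ‖r‖ ^ i) + 1,
    add_pos_of_nonneg_of_pos (Finset.sum_nonneg fun r _ => hnn r) one_pos, fun P hP r hr => ?_⟩
  refine (norm_aeval_le_of_natDegree_le hP r).trans ?_
  rw [mul_comm]
  refine mul_le_mul_of_nonneg_right ?_ (supNorm_nonneg P)
  have := Finset.single_le_sum (f := fun r : ℂ => ∑ i ∈ Finset.range (n + 1), ‖r‖ ^ i)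
    (fun r _ => hnn r) hr
  linarith

/-- Liouville's inequality for the distance from `ξ` to algebraic numbers of smaller degree,
taking into account that the complex conjugate of `ξ` is approximated equally well. -/
theorem exists_le_norm_sub_pow_mul_algHeight_pow {n : ℕ} {ξ : ℂ} (hξ : IsAlgebraic ℚ ξ)
    (hdeg : (minpoly ℚ ξ).natDegree = n + 1) :
    ∃ c : ℝ, 0 < c ∧ ∀ α ∈ algNumbersOfDegreeLE n, ‖ξ - α‖ ≤ 1 →
      c ≤ ‖ξ - α‖ ^ (conjPair ξ).card * algHeight α ^ (n + 1) := by
  obtain ⟨c, hc, hprod⟩ := exists_le_prod_norm_aeval_conjugates hξ n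
  obtain ⟨B, hB, hle⟩ := exists_norm_aeval_conjugates_le ξ n
  obtain ⟨K, hK, hroot⟩ := norm_aeval_le_mul_of_root n ξ
  generalize he : (conjPair ξ).card = e
  have hcard : (conjugates ξ \ conjPair ξ).card = n + 1 - e := by
    rw [Finset.card_sdiff_of_subset (conjPair_subset_conjugates hξ), card_conjugates hξ, hdeg, he]
  have hen : e ≤ n + 1 := by
    rw [← he, ← hdeg, ← card_conjugates hξ]
    exact Finset.card_le_card (conjPair_subset_conjugates hξ)
  refine ⟨c / (K ^ e * B ^ (n + 1 - e)), by positivity, fun α hα h1 => ?_⟩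
  have hd : (intMinpoly α).natDegree ≤ n := natDegree_intMinpoly hα.1 ▸ hα.2
  have h := hprod _ hd (aeval_ne_zero_of_natDegree_lt (intMinpoly_ne_zero α) (by omega))
  rw [← Finset.prod_sdiff (conjPair_subset_conjugates hξ), prod_conjPair_norm_aeval, he] at h
  have hH : 0 ≤ algHeight α := supNorm_nonneg _
  have h2 : ∏ r ∈ conjugates ξ \ conjPair ξ, ‖aeval r (intMinpoly α)‖ ≤
      (B * algHeight α) ^ (n + 1 - e) := by
    rw [← hcard, ← Finset.prod_const]
    exact Finset.prod_le_prod (fun r _ => norm_nonneg _)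
      fun r hr => hle _ hd r (Finset.mem_sdiff.mp hr).1
  have h3 : ‖aeval ξ (intMinpoly α)‖ ^ e ≤ (K * algHeight α * ‖ξ - α‖) ^ e :=
    pow_le_pow_left₀ (norm_nonneg _) (hroot _ α hd (aeval_intMinpoly hα.1) h1) e
  have h4 := h.trans (mul_le_mul h2 h3 (pow_nonneg (norm_nonneg _) _)
    (pow_nonneg (mul_nonneg hB.le hH) _))
  rw [div_le_iff₀ (by positivity)]
  refine h4.trans_eq ?_
  obtain ⟨m, hm⟩ := Nat.exists_eq_add_of_le hen
  rw [hm, Nat.add_sub_cancel_left, mul_pow, mul_pow, mul_pow, pow_add]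
  ring

/-! ### From distance estimates to the exponent. -/

/-- To compute Koksma's exponent up to its attained value, only the decay of the distance
with respect to the height matters, up to constants. -/
theorem koksmaExponent_eq_of_infinite {n : ℕ} {ξ : ℂ} {w c : ℝ}
    (hinf : {α ∈ algNumbersOfDegreeLE n |
      0 < ‖ξ - α‖ ∧ ‖ξ - α‖ ≤ c * algHeight α ^ (-w - 1)}.Infinite)
    (hfin : ∀ w' > w, ¬ {α ∈ algNumbersOfDegreeLE n |
      0 < ‖ξ - α‖ ∧ ‖ξ - α‖ ≤ algHeight α ^ (-w' - 1)}.Infinite) :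
    koksmaExponent n ξ = (w : EReal) := by
  refine le_antisymm (iSup₂_le fun w' hw' => ?_) ?_
  · rw [EReal.coe_le_coe_iff]
    by_contra hlt
    exact hfin w' (not_le.mp hlt) hw'
  · refine EReal.ge_of_forall_gt_iff_ge.mp fun v hv => ?_
    rw [EReal.coe_lt_coe_iff] at hv
    refine le_iSup₂ (f := fun (w : ℝ) (_ : w ∈ {w : ℝ | {α ∈ algNumbersOfDegreeLE n |
      0 < ‖ξ - α‖ ∧ ‖ξ - α‖ ≤ algHeight α ^ (-w - 1)}.Infinite}) => (w : EReal)) v ?_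
    -- For v < w the factor H^(w-v) absorbs c once H ≥ M; Northcott discards only finitely many α.
    obtain ⟨M, hM⟩ := Filter.eventually_atTop.mp
      ((tendsto_rpow_atTop (sub_pos.mpr hv)).eventually_ge_atTop c)
    refine (hinf.sdiff (finite_algHeight_le n M)).mono ?_
    rintro α ⟨⟨hα, h0, h1⟩, h2⟩
    have hMα : M ≤ algHeight α := by
      by_contra hlt
      exact h2 ⟨hα, (not_le.mp hlt).le⟩
    have hH : 0 < algHeight α := one_pos.trans_le (one_le_algHeight α)
    refine ⟨hα, h0, h1.trans ?_⟩
    calc c * algHeight α ^ (-w - 1) ≤ algHeight α ^ (w - v) * algHeight α ^ (-w - 1) := by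
          gcongr
          exact hM _ hMα
      _ = algHeight α ^ (-v - 1) := by
          rw [← Real.rpow_add hH]; congr 1; ring

/-- An effective lower bound `c ≤ ‖ξ - α‖ * H(α) ^ (w + 1)` near `ξ` bounds the exponent. -/
theorem not_infinite_of_lower_bound {n : ℕ} {ξ : ℂ} {w c : ℝ} (hc : 0 < c) (hw : -1 ≤ w)
    (hlow : ∀ α ∈ algNumbersOfDegreeLE n, ‖ξ - α‖ ≤ 1 → c ≤ ‖ξ - α‖ * algHeight α ^ (w + 1))
    {w' : ℝ} (hw' : w < w') :
    ¬ {α ∈ algNumbersOfDegreeLE n |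
      0 < ‖ξ - α‖ ∧ ‖ξ - α‖ ≤ algHeight α ^ (-w' - 1)}.Infinite := by
  rw [Set.not_infinite]
  obtain ⟨M, hM⟩ := Filter.eventually_atTop.mp
    ((tendsto_rpow_atTop (sub_pos.mpr hw')).eventually_gt_atTop c⁻¹)
  refine (finite_algHeight_le n M).subset ?_
  rintro α ⟨hα, -, h1⟩
  refine ⟨hα, ?_⟩
  by_contra hlt
  have hH1 := one_le_algHeight α
  have hH : 0 < algHeight α := one_pos.trans_le hH1
  -- Here -1 ≤ w < w' makes H^(-w'-1) at most 1, so `hlow` applies.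
  have h2 := hlow α hα (h1.trans (Real.rpow_le_one_of_one_le_of_nonpos hH1 (by linarith)))
  have h3 : c ≤ algHeight α ^ (-(w' - w)) := by
    refine h2.trans ((mul_le_mul_of_nonneg_right h1 (by positivity)).trans_eq ?_)
    rw [← Real.rpow_add hH]; congr 1; ring
  have h4 := hM _ (not_le.mp hlt).le
  rw [Real.rpow_neg hH.le, le_inv_comm₀ hc (by positivity)] at h3
  linarith

/-! ### Integer polynomials with a small value at ξ. -/

/-- Dirichlet's pigeonhole principle for finitely many real linear forms. -/
theorem exists_int_vector_small_linear_forms {ι : Type*} [Fintype ι] (n : ℕ)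
    (A : ι → Fin (n + 1) → ℝ) :
    ∃ C : ℝ, 0 < C ∧ ∀ q : ℕ, 1 ≤ q → ∃ x : Fin (n + 1) → ℤ, x ≠ 0 ∧
      (∀ i, ‖x i‖ ≤ (q : ℝ) ^ Fintype.card ι) ∧
      ∀ k, |∑ i, A k i * x i| ≤ C * ((q : ℝ) ^ Fintype.card ι / (q : ℝ) ^ (n + 1)) := by
  classical
  set T : ℝ := ∑ k, ∑ i, |A k i| + 1 with hT
  have hTk : ∀ k, ∑ i, |A k i| < T := fun k => by
    have := Finset.single_le_sum (f := fun k => ∑ i, |A k i|)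
      (fun k _ => Finset.sum_nonneg fun i _ => abs_nonneg _) (Finset.mem_univ k)
    linarith
  have hT0 : 0 < T := by positivity
  refine ⟨2 * T, by positivity, fun q hq => ?_⟩
  -- For e forms, M^e = N^(n+1) < (N+1)^(n+1): there are more integer vectors than boxes.
  obtain ⟨N, hN⟩ : ∃ N : ℕ, N = q ^ Fintype.card ι := ⟨_, rfl⟩
  obtain ⟨M, hM⟩ : ∃ M : ℕ, M = q ^ (n + 1) := ⟨_, rfl⟩
  have hN0 : 0 < N := hN ▸ pow_pos hq _
  have hM0 : 0 < M := hM ▸ pow_pos hq _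
  have hNR : (0 : ℝ) < N := by exact_mod_cast hN0
  have hMR : (0 : ℝ) < M := by exact_mod_cast hM0
  let y : ι → (Fin (n + 1) → Fin (N + 1)) → ℝ := fun k x => ∑ i, A k i * (x i : ℕ)
  have hy : ∀ k x, |y k x| < T * N := fun k x => by
    refine (Finset.abs_sum_le_sum_abs _ _).trans_lt ?_
    refine lt_of_le_of_lt ?_ (mul_lt_mul_of_pos_right (hTk k) hNR)
    rw [Finset.sum_mul]
    refine Finset.sum_le_sum fun i _ => ?_
    rw [abs_mul, Nat.abs_cast]
    gcongr
    exact_mod_cast Nat.lt_succ_iff.mp (x i).2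
  -- Rescaling from (-TN, TN) to [0, M). The `+ 1` in T makes the bounds strict, so the floors lie
  -- in `Fin M`.
  let z : ι → (Fin (n + 1) → Fin (N + 1)) → ℝ := fun k x => (y k x + T * N) / (2 * T * N) * M
  have hz0 : ∀ k x, 0 ≤ z k x := fun k x => by
    have := neg_lt_of_abs_lt (hy k x)
    exact mul_nonneg (div_nonneg (by linarith) (by positivity)) hMR.le
  have hzM : ∀ k x, z k x < M := fun k x => by
    have := lt_of_abs_lt (hy k x)
    refine mul_lt_of_lt_one_left hMR ?_
    rw [div_lt_one (by positivity)]
    linarith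
  let F : (Fin (n + 1) → Fin (N + 1)) → (ι → Fin M) := fun x k =>
    ⟨⌊z k x⌋₊, (Nat.floor_lt (hz0 k x)).mpr (hzM k x)⟩
  have hcard : Fintype.card (ι → Fin M) < Fintype.card (Fin (n + 1) → Fin (N + 1)) := by
    rw [Fintype.card_fun, Fintype.card_fun, Fintype.card_fin, Fintype.card_fin, Fintype.card_fin,
      hM, ← pow_mul, mul_comm, pow_mul, ← hN]
    exact Nat.pow_lt_pow_left (Nat.lt_succ_self N) n.succ_ne_zero
  obtain ⟨a, b, hab, hF⟩ := Fintype.exists_ne_map_eq_of_card_lt F hcard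
  refine ⟨fun i => ((a i : ℕ) : ℤ) - ((b i : ℕ) : ℤ), ?_, ?_, ?_⟩
  · intro h
    refine hab (funext fun i => Fin.ext ?_)
    have := congrFun h i
    simp only [Pi.zero_apply] at this
    omega
  · intro i
    have h1 : |((a i : ℕ) : ℤ) - ((b i : ℕ) : ℤ)| ≤ (N : ℤ) := by
      have := (a i).2
      have := (b i).2
      rw [abs_le]
      omega
    rw [Int.norm_eq_abs, ← Nat.cast_pow, ← hN]
    exact_mod_cast h1
  · intro k
    have h1 : ⌊z k a⌋₊ = ⌊z k b⌋₊ := congrArg Fin.val (congrFun hF k)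
    have h2 : |z k a - z k b| < 1 := by
      have ha := Nat.floor_le (hz0 k a)
      have hb := Nat.floor_le (hz0 k b)
      have ha' := Nat.lt_floor_add_one (z k a)
      have hb' := Nat.lt_floor_add_one (z k b)
      rw [h1] at ha ha'
      rw [abs_lt]
      constructor <;> linarith
    have h3 : ∑ i, A k i * ((((a i : ℕ) : ℤ) - ((b i : ℕ) : ℤ) : ℤ) : ℝ) =
        (z k a - z k b) * (2 * T * N / M) := by
      have : (z k a - z k b) * (2 * T * N / M) = y k a - y k b := by
        simp only [z]
        field_simp
        ring
      rw [this, ← Finset.sum_sub_distrib]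
      refine Finset.sum_congr rfl fun i _ => ?_
      push_cast
      ring
    rw [h3, abs_mul, abs_of_pos (a := 2 * T * N / M) (by positivity)]
    have h4 : 2 * T * N / M = 2 * T * ((q : ℝ) ^ Fintype.card ι / (q : ℝ) ^ (n + 1)) := by
      rw [hN, hM]
      push_cast
      ring
    rw [← h4]
    exact mul_le_of_le_one_left (by positivity) h2.le

theorem supNorm_le_of_forall {P : ℤ[X]} {B : ℝ} (h : ∀ i, ‖P.coeff i‖ ≤ B) : P.supNorm ≤ B := by
  obtain ⟨i, hi⟩ := P.exists_eq_supNorm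
  exact hi ▸ h i

theorem aeval_ofFn {n : ℕ} (x : Fin (n + 1) → ℤ) (ξ : ℂ) :
    aeval ξ (ofFn (n + 1) x) = ∑ i : Fin (n + 1), (x i : ℂ) * ξ ^ (i : ℕ) := by
  rw [aeval_eq_sum_range' (ofFn_natDegree_lt (Nat.le_add_left 1 n) x), Finset.sum_range]
  refine Finset.sum_congr rfl fun i _ => ?_
  rw [ofFn_coeff_eq_val_of_lt _ i.2, zsmul_eq_mul]

/-- Integer polynomials with small coefficients taking a small value at `ξ`. -/
theorem exists_polynomial_small_value (n : ℕ) (ξ : ℂ) :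
    ∃ C : ℝ, 0 < C ∧ ∀ q : ℕ, 1 ≤ q → ∃ P : ℤ[X], P ≠ 0 ∧ P.natDegree ≤ n ∧
      P.supNorm ≤ (q : ℝ) ^ (conjPair ξ).card ∧
      ‖aeval ξ P‖ ≤ C * ((q : ℝ) ^ (conjPair ξ).card / (q : ℝ) ^ (n + 1)) := by
  classical
  -- For real ξ the imaginary part vanishes and one form suffices; otherwise real and imaginary
  -- parts give two.
  obtain ⟨e, A, hA, he⟩ : ∃ (e : ℕ) (A : Fin e → Fin (n + 1) → ℝ),
      (∀ (x : Fin (n + 1) → ℤ) (B : ℝ), (∀ k, |∑ i, A k i * x i| ≤ B) →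
        ‖∑ i : Fin (n + 1), (x i : ℂ) * ξ ^ (i : ℕ)‖ ≤ 2 * B) ∧ e = (conjPair ξ).card := by
    have hre : ∀ x : Fin (n + 1) → ℤ, (∑ i : Fin (n + 1), (x i : ℂ) * ξ ^ (i : ℕ)).re =
        ∑ i : Fin (n + 1), (ξ ^ (i : ℕ)).re * x i := fun x => by
      rw [Complex.re_sum]
      refine Finset.sum_congr rfl fun i _ => ?_
      rw [← Complex.ofReal_intCast, Complex.re_ofReal_mul, mul_comm]
    have him : ∀ x : Fin (n + 1) → ℤ, (∑ i : Fin (n + 1), (x i : ℂ) * ξ ^ (i : ℕ)).im =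
        ∑ i : Fin (n + 1), (ξ ^ (i : ℕ)).im * x i := fun x => by
      rw [Complex.im_sum]
      refine Finset.sum_congr rfl fun i _ => ?_
      rw [← Complex.ofReal_intCast, Complex.im_ofReal_mul, mul_comm]
    by_cases hc : starRingEnd ℂ ξ = ξ
    · refine ⟨1, fun _ i => (ξ ^ (i : ℕ)).re, fun x B hB => ?_, ?_⟩
      · have h0 := hB 0
        refine (Complex.norm_le_abs_re_add_abs_im _).trans ?_
        have h1 : (∑ i : Fin (n + 1), (x i : ℂ) * ξ ^ (i : ℕ)).im = 0 := by
          rw [← Complex.conj_eq_iff_im]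
          simp [hc]
        rw [h1, hre, abs_zero]
        linarith [abs_nonneg (∑ i : Fin (n + 1), (ξ ^ (i : ℕ)).re * (x i : ℝ))]
      · rw [conjPair, hc, Finset.pair_eq_singleton, Finset.card_singleton]
    · refine ⟨2, ![fun i => (ξ ^ (i : ℕ)).re, fun i => (ξ ^ (i : ℕ)).im], fun x B hB => ?_, ?_⟩
      · have h0 := hB 0
        have h1 := hB 1
        simp only [Matrix.cons_val_zero, Matrix.cons_val_one] at h0 h1
        refine (Complex.norm_le_abs_re_add_abs_im _).trans ?_
        rw [hre, him]
        linarith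
      · rw [conjPair, Finset.card_pair (Ne.symm hc)]
  obtain ⟨C, hC, h⟩ := exists_int_vector_small_linear_forms n A
  refine ⟨2 * C, by positivity, fun q hq => ?_⟩
  obtain ⟨x, hx0, hx, hsmall⟩ := h q hq
  rw [Fintype.card_fin] at hx hsmall
  rw [← he]
  refine ⟨ofFn (n + 1) x, ?_, ?_, ?_, ?_⟩
  · intro h0
    refine hx0 (funext fun i => ?_)
    rw [← ofFn_coeff_eq_val_of_lt x i.2, h0, coeff_zero, Pi.zero_apply]
  · exact Nat.lt_succ_iff.mp (ofFn_natDegree_lt (Nat.le_add_left 1 n) x)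
  · refine supNorm_le_of_forall fun i => ?_
    by_cases hi : i < n + 1
    · rw [ofFn_coeff_eq_val_of_lt x hi]
      exact hx _
    · rw [ofFn_coeff_eq_zero_of_ge x (not_lt.mp hi), norm_zero]
      positivity
  · rw [aeval_ofFn, mul_assoc]
    exact hA x _ hsmall

/-! ### Multiplication by powers of ξ on integer polynomials of degree at most n. -/

/-- Reduction of monomials modulo the minimal polynomial, after clearing denominators. -/
theorem exists_reduction_X_pow {n : ℕ} {ξ : ℂ} (hξ : IsAlgebraic ℚ ξ)
    (hdeg : (minpoly ℚ ξ).natDegree = n + 1) (m : ℕ) :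
    ∃ G : ℤ[X], G.natDegree ≤ n ∧ ∀ r ∈ conjugates ξ,
      aeval r G = ((intMinpoly ξ).leadingCoeff : ℂ) ^ m * r ^ m := by
  induction m with
  | zero => exact ⟨1, by simp, by simp⟩
  | succ m ih =>
    obtain ⟨G, hG, hr⟩ := ih
    have hf : (intMinpoly ξ).natDegree = n + 1 := natDegree_intMinpoly hξ ▸ hdeg
    -- The subtracted multiple of the minimal polynomial cancels the coefficient of X^(n+1).
    refine ⟨C (intMinpoly ξ).leadingCoeff * (G * X) - C (G.coeff n) * intMinpoly ξ, ?_, ?_⟩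
    · rw [natDegree_le_iff_coeff_eq_zero]
      intro i hi
      obtain ⟨k, rfl⟩ : ∃ k, i = k + 1 := ⟨i - 1, by omega⟩
      rw [coeff_sub, coeff_C_mul, coeff_C_mul, coeff_mul_X]
      rcases Nat.eq_or_lt_of_le (show n ≤ k by omega) with rfl | hk
      · rw [leadingCoeff, hf]; ring
      · rw [coeff_eq_zero_of_natDegree_lt (p := G) (by omega),
          coeff_eq_zero_of_natDegree_lt (p := intMinpoly ξ) (by omega)]
        ring
    · intro r hrm
      have h0 := (aeval_intMinpoly_eq_zero_iff hξ r).mpr ((mem_conjugates hξ).mp hrm)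
      rw [map_sub, map_mul, map_mul, map_mul, h0, hr r hrm, aeval_X, aeval_C]
      simp only [algebraMap_int_eq, eq_intCast]
      ring

/-- Multiplication by powers of `ξ` on the lattice of integer polynomials of degree at most `n`,
viewed as a lattice in `ℚ(ξ)`. -/
theorem exists_mul_pow_reduction {n : ℕ} {ξ : ℂ} (hξ : IsAlgebraic ℚ ξ)
    (hdeg : (minpoly ℚ ξ).natDegree = n + 1) :
    ∃ (b : ℂ) (K : ℝ), b ≠ 0 ∧ 0 < K ∧ ∀ P : ℤ[X], P.natDegree ≤ n →
      ∃ Q : ℕ → ℤ[X], ∀ j ≤ n, (Q j).natDegree ≤ n ∧ (Q j).supNorm ≤ K * P.supNorm ∧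
        ∀ r ∈ conjugates ξ, aeval r (Q j) = r ^ j * (b * aeval r P) := by
  choose G hG hr using exists_reduction_X_pow hξ hdeg
  set a := (intMinpoly ξ).leadingCoeff with ha
  have ha0 : (a : ℂ) ≠ 0 := by
    exact_mod_cast leadingCoeff_ne_zero.mpr (intMinpoly_ne_zero ξ)
  -- The extra power of a gives every monomial up to degree 2n, the largest k + j needed, the same
  -- denominator a^(2n).
  let D : ℕ → ℤ[X] := fun m => C (a ^ (2 * n - m)) * G m
  have hD : ∀ m ≤ 2 * n, ∀ r ∈ conjugates ξ, aeval r (D m) = (a : ℂ) ^ (2 * n) * r ^ m := by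
    intro m hm r hrm
    rw [map_mul, hr m r hrm, aeval_C]
    simp only [algebraMap_int_eq, eq_intCast, Int.cast_pow]
    rw [← mul_assoc, ← pow_add, Nat.sub_add_cancel hm]
  have hDdeg : ∀ m, (D m).natDegree ≤ n := fun m => (natDegree_C_mul_le _ _).trans (hG m)
  set K : ℝ := ∑ j ∈ Finset.range (n + 1), ∑ k ∈ Finset.range (n + 1), (D (k + j)).supNorm + 1
    with hK
  have hKnn : ∀ j, 0 ≤ ∑ k ∈ Finset.range (n + 1), (D (k + j)).supNorm :=
    fun j => Finset.sum_nonneg fun k _ => supNorm_nonneg _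
  refine ⟨(a : ℂ) ^ (2 * n), K, pow_ne_zero _ ha0,
    add_pos_of_nonneg_of_pos (Finset.sum_nonneg fun j _ => hKnn j) one_pos, fun P hP => ?_⟩
  refine ⟨fun j => ∑ k ∈ Finset.range (n + 1), C (P.coeff k) * D (k + j), fun j hj => ⟨?_, ?_, ?_⟩⟩
  · exact natDegree_sum_le_of_forall_le _ _ fun k _ => (natDegree_C_mul_le _ _).trans (hDdeg _)
  · refine supNorm_le_of_forall fun i => ?_
    rw [finsetSum_coeff]
    refine (norm_sum_le_of_le (n := fun k => P.supNorm * (D (k + j)).supNorm) _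
      fun k _ => ?_).trans ?_
    · rw [coeff_C_mul]
      exact (norm_mul_le _ _).trans
        (mul_le_mul (P.le_supNorm k) (le_supNorm _ i) (norm_nonneg _) (supNorm_nonneg _))
    · rw [← Finset.mul_sum, mul_comm]
      refine mul_le_mul_of_nonneg_right ?_ (supNorm_nonneg P)
      have := Finset.single_le_sum
        (f := fun j => ∑ k ∈ Finset.range (n + 1), (D (k + j)).supNorm)
        (fun j _ => hKnn j) (Finset.mem_range.mpr (Nat.lt_succ_of_le hj))
      linarith
  · intro r hrm
    rw [map_sum, aeval_eq_sum_range' (Nat.lt_succ_of_le hP), Finset.mul_sum, Finset.mul_sum]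
    refine Finset.sum_congr rfl fun k hk => ?_
    have hk' := Finset.mem_range.mp hk
    rw [map_mul, hD (k + j) (by omega) r hrm, aeval_C, pow_add, zsmul_eq_mul]
    simp only [algebraMap_int_eq, eq_intCast]
    ring

/-! ### A large derivative forces a nearby root. -/

/-- If `T j` interpolates `r ^ j * v r` on a finite set `R`, then the derivative of some `T j` at
`ξ ∈ R` is controlled from below by the value of `v` at any other point of `R`. -/
theorem exists_le_norm_eval_derivative {R : Finset ℂ} {n : ℕ} (hR : R.card = n + 1) {ξ s : ℂ}
    (hξ : ξ ∈ R) (hs : s ∈ R) (hne : s ≠ ξ) :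
    ∃ c : ℝ, 0 < c ∧ ∀ (v : ℂ → ℂ) (T : ℕ → ℂ[X]), (∀ j ≤ n, (T j).natDegree ≤ n) →
      (∀ j ≤ n, ∀ r ∈ R, (T j).eval r = r ^ j * v r) →
      ∃ j ≤ n, c * ‖v s‖ ≤ ‖(derivative (T j)).eval ξ‖ := by
  classical
  set L : ℂ[X] := ∏ r ∈ R.erase s, (X - C r) with hL
  have hLdeg : L.natDegree = n := by
    rw [hL, natDegree_finsetProd_X_sub_C_eq_card, Finset.card_erase_of_mem hs, hR,
      Nat.add_sub_cancel]
  have hξ' : ξ ∈ R.erase s := Finset.mem_erase.mpr ⟨hne.symm, hξ⟩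
  have hL' : (derivative L).eval ξ ≠ 0 := by
    rw [hL, ← Finset.mul_prod_erase _ _ hξ', derivative_mul, eval_add, eval_mul, eval_mul,
      derivative_X_sub_C, eval_one, one_mul, eval_sub, eval_X, eval_C, sub_self, zero_mul, add_zero,
      eval_prod]
    refine Finset.prod_ne_zero_iff.mpr fun r hr => ?_
    rw [eval_sub, eval_X, eval_C, sub_ne_zero]
    exact (Finset.ne_of_mem_erase hr).symm
  have hLr : ∀ r ∈ R, r ≠ s → L.eval r = 0 := fun r hr hrs => by
    rw [hL, eval_prod]
    exact Finset.prod_eq_zero (Finset.mem_erase.mpr ⟨hrs, hr⟩) (by simp)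
  set U : ℝ := ∑ j ∈ Finset.range (n + 1), ‖L.coeff j‖ with hU
  have hU0 : 0 ≤ U := Finset.sum_nonneg fun j _ => norm_nonneg _
  refine ⟨‖(derivative L).eval ξ‖ / (U + 1), by positivity, fun v T hT hv => ?_⟩
  by_contra! hcon
  -- Both sides have degree at most n and agree at the n+1 points of R. Since ξ is a simple root of
  -- L, differentiating there prevents all the derivatives of the T j from being small.
  have hsum : ∑ j ∈ Finset.range (n + 1), C (L.coeff j) * T j = C (v s) * L := by
    refine eq_of_degrees_lt_of_eval_finset_eq R ?_ ?_ fun r hr => ?_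
    · refine (degree_le_of_natDegree_le (natDegree_sum_le_of_forall_le (n := n) _ _
        fun j hj => (natDegree_C_mul_le _ _).trans
          (hT j (Nat.lt_succ_iff.mp (Finset.mem_range.mp hj))))).trans_lt ?_
      rw [hR]
      exact_mod_cast Nat.lt_succ_self n
    · refine (degree_le_of_natDegree_le ((natDegree_C_mul_le _ _).trans hLdeg.le)).trans_lt ?_
      rw [hR]
      exact_mod_cast Nat.lt_succ_self n
    · rw [eval_finsetSum]
      have : ∑ j ∈ Finset.range (n + 1), (C (L.coeff j) * T j).eval r = v r * L.eval r := by
        rw [eval_eq_sum_range' (show L.natDegree < n + 1 by omega), Finset.mul_sum]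
        refine Finset.sum_congr rfl fun j hj => ?_
        rw [eval_mul, eval_C, hv j (Nat.lt_succ_iff.mp (Finset.mem_range.mp hj)) r hr]
        ring
      rw [this, eval_mul, eval_C]
      by_cases hrs : r = s
      · rw [hrs]
      · rw [hLr r hr hrs, mul_zero, mul_zero]
  have hder := congrArg (fun p : ℂ[X] => ‖(derivative p).eval ξ‖) hsum
  simp only [derivative_sum, derivative_C_mul, eval_finsetSum, eval_mul, eval_C, norm_mul] at hder
  have hle : ‖v s‖ * ‖(derivative L).eval ξ‖ ≤
      U * (‖(derivative L).eval ξ‖ / (U + 1) * ‖v s‖) := by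
    rw [← hder, hU, Finset.sum_mul]
    refine norm_sum_le_of_le _ fun j hj => ?_
    rw [norm_mul]
    exact mul_le_mul_of_nonneg_left (hcon j (Nat.lt_succ_iff.mp (Finset.mem_range.mp hj))).le
      (norm_nonneg _)
  have hvs : 0 < ‖v s‖ := by
    by_contra h0
    have h1 : ‖v s‖ = 0 := le_antisymm (not_lt.mp h0) (norm_nonneg _)
    have := hcon 0 (Nat.zero_le n)
    rw [h1, mul_zero] at this
    exact absurd this (not_lt.mpr (norm_nonneg _))
  have hpos : 0 < ‖v s‖ * ‖(derivative L).eval ξ‖ := mul_pos hvs (norm_pos_iff.mpr hL')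
  have : U * (‖(derivative L).eval ξ‖ / (U + 1) * ‖v s‖) =
      (‖v s‖ * ‖(derivative L).eval ξ‖) * (U / (U + 1)) := by ring
  rw [this] at hle
  have hlt : U / (U + 1) < 1 := (div_lt_one (by positivity)).mpr (by linarith)
  nlinarith

/-- Laguerre-type bound: a polynomial has a root close to any point where its logarithmic
derivative is large. -/
theorem exists_root_norm_sub_mul_le {P : ℂ[X]} {n : ℕ} (hn : P.natDegree ≤ n) {ξ : ℂ}
    (h0 : P.eval ξ ≠ 0) (h1 : (derivative P).eval ξ ≠ 0) :
    ∃ α, P.eval α = 0 ∧ ‖ξ - α‖ * ‖(derivative P).eval ξ‖ ≤ n * ‖P.eval ξ‖ := by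
  classical
  have hP : P ≠ 0 := fun h => h0 (by rw [h, eval_zero])
  have hsplit := IsAlgClosed.splits P
  have heq := hsplit.eval_derivative_eq_eval_mul_sum h0
  have hne : P.roots.toFinset.Nonempty := by
    rw [Multiset.toFinset_nonempty]
    intro h
    rw [h, Multiset.map_zero, Multiset.sum_zero, mul_zero] at heq
    exact h1 heq
  -- With α the nearest root, each term of P'/P = ∑ 1/(ξ - z) is at most 1/|ξ - α|.
  obtain ⟨α, hα, hmin⟩ := Finset.exists_min_image _ (fun z => ‖ξ - z‖) hne
  rw [Multiset.mem_toFinset, mem_roots hP] at hα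
  have hpos : 0 < ‖ξ - α‖ := by
    rw [norm_pos_iff, sub_ne_zero]
    rintro rfl
    exact h0 hα
  refine ⟨α, hα, ?_⟩
  have hsum : ‖(P.roots.map fun z => 1 / (ξ - z)).sum‖ ≤ n * ‖ξ - α‖⁻¹ := by
    refine (norm_multiset_sum_le _).trans ((Multiset.sum_le_card_nsmul _ ‖ξ - α‖⁻¹ ?_).trans ?_)
    · intro x hx
      rw [Multiset.map_map, Multiset.mem_map] at hx
      obtain ⟨z, hz, rfl⟩ := hx
      rw [Function.comp_apply, norm_div, norm_one, one_div]
      exact inv_anti₀ hpos (hmin z (Multiset.mem_toFinset.mpr hz))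
    · rw [Multiset.card_map, Multiset.card_map, nsmul_eq_mul]
      gcongr
      exact (card_roots' P).trans hn
  rw [heq, norm_mul]
  calc ‖ξ - α‖ * (‖P.eval ξ‖ * ‖(P.roots.map fun z => 1 / (ξ - z)).sum‖)
      ≤ ‖ξ - α‖ * (‖P.eval ξ‖ * (n * ‖ξ - α‖⁻¹)) := by gcongr
    _ = n * ‖P.eval ξ‖ := by field_simp

/-! ### Construction of good approximations. -/

/-- Algebraic numbers of degree at most `n` close to `ξ`, provided that `ξ` has a conjugate other
than itself and its complex conjugate. -/
theorem exists_close_algebraic {n : ℕ} {ξ : ℂ} (hξ : IsAlgebraic ℚ ξ)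
    (hdeg : (minpoly ℚ ξ).natDegree = n + 1) (hcard : (conjPair ξ).card ≤ n) :
    ∃ C₁ C₂ : ℝ, 0 < C₁ ∧ 0 < C₂ ∧ ∀ q : ℕ, 1 ≤ q → ∃ α ∈ algNumbersOfDegreeLE n,
      ‖ξ - α‖ ≤ C₁ / (q : ℝ) ^ (n + 1) ∧ algHeight α ≤ C₂ * (q : ℝ) ^ (conjPair ξ).card := by
  obtain ⟨c₀, hc₀, hprod⟩ := exists_le_prod_norm_aeval_conjugates hξ n
  obtain ⟨B, hB, hle⟩ := exists_norm_aeval_conjugates_le ξ n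
  obtain ⟨C, hC, hsmall⟩ := exists_polynomial_small_value n ξ
  obtain ⟨b, K, hb, hK, hred⟩ := exists_mul_pow_reduction hξ hdeg
  have hsub := conjPair_subset_conjugates hξ
  have hRcard : (conjugates ξ).card = n + 1 := (card_conjugates hξ).trans hdeg
  have hξR : ξ ∈ conjugates ξ := hsub (self_mem_conjPair ξ)
  have hdiff : (conjugates ξ \ conjPair ξ).card = n + 1 - (conjPair ξ).card := by
    rw [Finset.card_sdiff_of_subset hsub, hRcard]
  obtain ⟨s, hs⟩ : (conjugates ξ \ conjPair ξ).Nonempty := Finset.card_pos.mp (by omega)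
  obtain ⟨hsR, hsS⟩ := Finset.mem_sdiff.mp hs
  have hsξ : s ≠ ξ := fun h => hsS (h ▸ self_mem_conjPair ξ)
  obtain ⟨c, hc, hder⟩ := exists_le_norm_eval_derivative hRcard hξR hsR hsξ
  -- Needed for ξ^j b P(ξ), the value of Q_j at ξ, to be nonzero.
  have hξ0 : ξ ≠ 0 := by
    rintro rfl
    have := card_conjPair_pos (0 : ℂ)
    rw [minpoly.zero, natDegree_X] at hdeg
    omega
  have hpow : ∀ i ≤ n, ‖ξ ^ i‖ ≤ (‖ξ‖ + 1) ^ n := fun i hi => by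
    rw [norm_pow]
    exact (pow_le_pow_left₀ (norm_nonneg _) (by linarith) i).trans
      (pow_le_pow_right₀ (by linarith [norm_nonneg ξ]) hi)
  generalize he : (conjPair ξ).card = e at *
  set c₁ : ℝ := c₀ / (C ^ e * B ^ (n - e)) with hc₁
  have hc₁0 : 0 < c₁ := by positivity
  refine ⟨n * ((‖ξ‖ + 1) ^ n * C) / (c * c₁), 2 ^ n * (n + 1) * K, ?_, by positivity,
    fun q hq => ?_⟩
  · have : 0 < n := (he ▸ card_conjPair_pos ξ).trans_le hcard
    positivity
  obtain ⟨P, hP0, hPn, hPH, hPξ⟩ := hsmall q hq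
  have hqR : (0 : ℝ) < q := by exact_mod_cast hq
  have hPξ0 : aeval ξ P ≠ 0 := aeval_ne_zero_of_natDegree_lt hP0 (by omega)
  -- In the norm bound, the pair contributes at most q^(e(e-n-1)) and the n-e conjugates other than
  -- s at most q^(e(n-e)), up to constants; q^e is left for |P(s)|.
  have hlow : c₁ * (q : ℝ) ^ e ≤ ‖aeval s P‖ := by
    have h := hprod P hPn hPξ0
    rw [← Finset.prod_sdiff hsub, prod_conjPair_norm_aeval, he,
      ← Finset.mul_prod_erase _ _ hs] at h
    have h2 : ∏ r ∈ (conjugates ξ \ conjPair ξ).erase s, ‖aeval r P‖ ≤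
        (B * (q : ℝ) ^ e) ^ (n - e) := by
      have hcd : ((conjugates ξ \ conjPair ξ).erase s).card = n - e := by
        rw [Finset.card_erase_of_mem hs, hdiff]
        omega
      rw [← hcd, ← Finset.prod_const]
      refine Finset.prod_le_prod (fun r _ => norm_nonneg _) fun r hr => ?_
      exact (hle P hPn r (Finset.mem_sdiff.mp (Finset.mem_of_mem_erase hr)).1).trans
        (mul_le_mul_of_nonneg_left hPH hB.le)
    have h3 : ‖aeval ξ P‖ ^ e ≤ (C * ((q : ℝ) ^ e / (q : ℝ) ^ (n + 1))) ^ e :=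
      pow_le_pow_left₀ (norm_nonneg _) hPξ e
    have h4 := h.trans (mul_le_mul (mul_le_mul_of_nonneg_left h2 (norm_nonneg (aeval s P))) h3
      (by positivity) (by positivity))
    rw [hc₁, div_mul_eq_mul_div, div_le_iff₀ (by positivity)]
    refine (mul_le_mul_of_nonneg_right h4 (by positivity : 0 ≤ (q : ℝ) ^ e)).trans_eq ?_
    obtain ⟨m, rfl⟩ := Nat.exists_eq_add_of_le hcard
    rw [Nat.add_sub_cancel_left, mul_pow, mul_pow, div_pow]
    have : ((q : ℝ) ^ e) ^ m * ((q : ℝ) ^ e) ^ e * (q : ℝ) ^ e = ((q : ℝ) ^ (e + m + 1)) ^ e := by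
      rw [← pow_mul, ← pow_mul, ← pow_mul, ← pow_add, ← pow_add]
      congr 1
      ring
    have hq0 : ((q : ℝ) ^ (e + m + 1)) ^ e ≠ 0 := by positivity
    field_simp
    linear_combination ‖aeval s P‖ * this
  obtain ⟨Q, hQ⟩ := hred P hPn
  obtain ⟨j, hj, hjder⟩ := hder (fun r => b * aeval r P)
    (fun j => (Q j).map (algebraMap ℤ ℂ)) (fun j hj => natDegree_map_le.trans (hQ j hj).1)
    (fun j hj r hr => by rw [eval_map_algebraMap]; exact (hQ j hj).2.2 r hr)
  obtain ⟨hQn, hQH, hQv⟩ := hQ j hj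
  have hb0 : 0 < ‖b‖ := norm_pos_iff.mpr hb
  have hval : ((Q j).map (algebraMap ℤ ℂ)).eval ξ = ξ ^ j * (b * aeval ξ P) := by
    rw [eval_map_algebraMap]; exact hQv ξ hξR
  have hval0 : ((Q j).map (algebraMap ℤ ℂ)).eval ξ ≠ 0 := by
    rw [hval]; exact mul_ne_zero (pow_ne_zero _ hξ0) (mul_ne_zero hb hPξ0)
  have hderlow : ‖b‖ * (c * c₁ * (q : ℝ) ^ e) ≤
      ‖(derivative ((Q j).map (algebraMap ℤ ℂ))).eval ξ‖ := by
    refine le_trans ?_ hjder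
    rw [norm_mul]
    have := mul_le_mul_of_nonneg_left hlow (by positivity : 0 ≤ ‖b‖ * c)
    linarith
  have hder0 : (derivative ((Q j).map (algebraMap ℤ ℂ))).eval ξ ≠ 0 :=
    norm_pos_iff.mp ((by positivity : 0 < ‖b‖ * (c * c₁ * (q : ℝ) ^ e)).trans_le hderlow)
  obtain ⟨α, hα, hclose⟩ := exists_root_norm_sub_mul_le (natDegree_map_le.trans hQn) hval0 hder0
  rw [eval_map_algebraMap] at hα
  have hQ0 : Q j ≠ 0 := fun h => hval0 (by rw [h, Polynomial.map_zero, eval_zero])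
  obtain ⟨hαn, hαH⟩ := algHeight_le_of_root hQ0 hQn hα
  refine ⟨α, hαn, ?_, hαH.trans ?_⟩
  · have h1 : ‖((Q j).map (algebraMap ℤ ℂ)).eval ξ‖ ≤
        (‖ξ‖ + 1) ^ n * (‖b‖ * (C * ((q : ℝ) ^ e / (q : ℝ) ^ (n + 1)))) := by
      rw [hval, norm_mul, norm_mul]
      gcongr
      exact hpow j hj
    have h2 := (mul_le_mul_of_nonneg_left hderlow (norm_nonneg (ξ - α))).trans
      (hclose.trans (mul_le_mul_of_nonneg_left h1 (Nat.cast_nonneg n)))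
    rw [div_div, le_div_iff₀ (by positivity)]
    refine le_of_mul_le_mul_right ?_ (by positivity : 0 < ‖b‖ * (q : ℝ) ^ e / (q : ℝ) ^ (n + 1))
    calc _ = ‖ξ - α‖ * (‖b‖ * (c * c₁ * (q : ℝ) ^ e)) := by field_simp
      _ ≤ _ := h2
      _ = _ := by ring
  · rw [mul_assoc _ K]
    exact mul_le_mul_of_nonneg_left (hQH.trans (mul_le_mul_of_nonneg_left hPH hK.le))
      (by positivity)

theorem sub_ne_zero_of_mem_algNumbersOfDegreeLE {n : ℕ} {ξ α : ℂ}
    (hdeg : (minpoly ℚ ξ).natDegree = n + 1) (hα : α ∈ algNumbersOfDegreeLE n) : 0 < ‖ξ - α‖ := by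
  rw [norm_pos_iff, sub_ne_zero]
  rintro rfl
  have := hα.2
  omega

theorem rpow_div_le_of_le_mul_pow {x C q : ℝ} {e : ℕ} (n : ℕ) (he : 0 < e) (hx : 0 ≤ x)
    (hC : 0 ≤ C) (hq : 0 ≤ q) (h : x ≤ C * q ^ e) :
    x ^ ((n + 1 : ℝ) / e) ≤ C ^ ((n + 1 : ℝ) / e) * q ^ (n + 1) := by
  have heR : (0 : ℝ) < e := by exact_mod_cast he
  refine (Real.rpow_le_rpow hx h (by positivity)).trans_eq ?_
  rw [Real.mul_rpow hC (by positivity), ← Real.rpow_natCast, ← Real.rpow_mul hq,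
    ← Real.rpow_natCast]
  congr 2
  field_simp
  push_cast
  ring

theorem pow_mul_pow_rpow_inv {d x : ℝ} {e : ℕ} (n : ℕ) (he : 0 < e) (hd : 0 ≤ d) (hx : 0 ≤ x) :
    (d ^ e * x ^ (n + 1)) ^ (e : ℝ)⁻¹ = d * x ^ ((n + 1 : ℝ) / e) := by
  rw [Real.mul_rpow (by positivity) (by positivity), Real.pow_rpow_inv_natCast hd he.ne',
    ← Real.rpow_natCast, ← Real.rpow_mul hx, div_eq_mul_inv]
  push_cast
  rfl

/-- The height bound eliminates q from the distance bound. The distances are positive but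
arbitrarily small as q grows, so no finite set contains all these α. -/
theorem infinite_close_algebraic {n : ℕ} {ξ : ℂ} (hξ : IsAlgebraic ℚ ξ)
    (hdeg : (minpoly ℚ ξ).natDegree = n + 1) (hcard : (conjPair ξ).card ≤ n) :
    ∃ c : ℝ, 0 < c ∧ {α ∈ algNumbersOfDegreeLE n | 0 < ‖ξ - α‖ ∧
      ‖ξ - α‖ ≤ c * algHeight α ^ (-((n + 1 : ℝ) / (conjPair ξ).card))}.Infinite := by
  obtain ⟨C₁, C₂, hC₁, hC₂, h⟩ := exists_close_algebraic hξ hdeg hcard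
  have he0 := card_conjPair_pos ξ
  generalize (conjPair ξ).card = e at *
  have heR : (0 : ℝ) < e := by exact_mod_cast he0
  set t : ℝ := (n + 1 : ℝ) / e with ht
  have ht0 : 0 ≤ t := by positivity
  refine ⟨C₁ * C₂ ^ t, by positivity, fun hfin => ?_⟩
  have hmem : ∀ q : ℕ, 1 ≤ q → ∃ α ∈ {α ∈ algNumbersOfDegreeLE n | 0 < ‖ξ - α‖ ∧
      ‖ξ - α‖ ≤ C₁ * C₂ ^ t * algHeight α ^ (-t)}, ‖ξ - α‖ ≤ C₁ / (q : ℝ) := by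
    intro q hq
    obtain ⟨α, hα, h1, h2⟩ := h q hq
    have hqR : (1 : ℝ) ≤ q := by exact_mod_cast hq
    have hH : 0 < algHeight α := one_pos.trans_le (one_le_algHeight α)
    refine ⟨α, ⟨hα, sub_ne_zero_of_mem_algNumbersOfDegreeLE hdeg hα, h1.trans ?_⟩, h1.trans ?_⟩
    · have h3 := rpow_div_le_of_le_mul_pow n he0 hH.le hC₂.le (zero_le_one.trans hqR) h2
      rw [Real.rpow_neg hH.le, ← div_eq_mul_inv,
        div_le_div_iff₀ (pow_pos (one_pos.trans_le hqR) _) (Real.rpow_pos_of_pos hH _), mul_assoc]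
      exact mul_le_mul_of_nonneg_left h3 hC₁.le
    · exact div_le_div_of_nonneg_left hC₁.le (by positivity) (le_self_pow₀ hqR n.succ_ne_zero)
  obtain ⟨β, hβ, hmin⟩ := Set.exists_min_image _ (fun α => ‖ξ - α‖) hfin
    (let ⟨α, hα, _⟩ := hmem 1 le_rfl; ⟨α, hα⟩)
  have hβ0 : 0 < ‖ξ - β‖ := hβ.2.1
  obtain ⟨q, hq⟩ := exists_nat_gt (C₁ / ‖ξ - β‖)
  have hq0 : (0 : ℝ) < q := (by positivity : 0 < C₁ / ‖ξ - β‖).trans hq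
  obtain ⟨α, hα, hαq⟩ := hmem q (by exact_mod_cast hq0)
  have := (hmin α hα).trans hαq
  rw [div_lt_iff₀ hβ0] at hq
  rw [le_div_iff₀ hq0] at this
  linarith

/-! ### The exceptional case n = 1 with ξ non-real, and the conclusion. -/

/-- The distance to a rational number is at least the imaginary part. -/
theorem abs_im_le_norm_sub_of_degree_one (ξ : ℂ) :
    ∀ α ∈ algNumbersOfDegreeLE 1, |ξ.im| ≤ ‖ξ - α‖ := by
  rintro α ⟨hα, hdeg⟩
  obtain ⟨a, rfl⟩ : α ∈ (algebraMap ℚ ℂ).range :=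
    minpoly.natDegree_eq_one_iff.mp
      (le_antisymm hdeg (minpoly.natDegree_pos hα.isIntegral))
  have := Complex.abs_im_le_norm (ξ - algebraMap ℚ ℂ a)
  simpa using this

/-- At exponent -1 the height enters to the power 0, so any infinite bounded family of rationals
will do. -/
theorem infinite_rational_bounded_distance (ξ : ℂ) (h : ∀ α ∈ algNumbersOfDegreeLE 1, 0 < ‖ξ - α‖) :
    {α ∈ algNumbersOfDegreeLE 1 | 0 < ‖ξ - α‖ ∧ ‖ξ - α‖ ≤ ‖ξ‖ + 1}.Infinite := by
  refine Set.infinite_of_injective_forall_mem (f := fun k : ℕ => algebraMap ℚ ℂ (1 / (k + 1)))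
    (fun a b hab => ?_) fun k => ?_
  · have := (algebraMap ℚ ℂ).injective hab
    rw [one_div, one_div, inv_inj] at this
    exact_mod_cast add_right_cancel this
  · have hmem : algebraMap ℚ ℂ (1 / (k + 1)) ∈ algNumbersOfDegreeLE 1 :=
      ⟨isAlgebraic_algebraMap _, by rw [minpoly.eq_X_sub_C, natDegree_X_sub_C]⟩
    refine ⟨hmem, h _ hmem, (norm_sub_le _ _).trans (add_le_add_right ?_ _)⟩
    have h1 : algebraMap ℚ ℂ (1 / (k + 1)) = ((1 / ((k : ℝ) + 1) : ℝ) : ℂ) := by simp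
    rw [h1, Complex.norm_real, Real.norm_eq_abs, abs_of_pos (by positivity),
      div_le_one (by positivity)]
    linarith [(Nat.cast_nonneg k : (0 : ℝ) ≤ k)]

theorem proposition10p2 (n : ℕ) (hn : 1 ≤ n) (ξ : ℂ) (hξ : IsAlgebraic ℚ ξ)
    (hdeg : (minpoly ℚ ξ).natDegree = n + 1) :
    ∃ w : ℝ, koksmaExponent n ξ = (w : EReal) ∧
      ∃ c : ℝ, 0 < c ∧
        {α ∈ algNumbersOfDegreeLE n |
          0 < ‖ξ - α‖ ∧ ‖ξ - α‖ ≤ c * algHeight α ^ (-w - 1)}.Infinite := by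
  by_cases hcard : (conjPair ξ).card ≤ n
  · obtain ⟨c, hc, hinf⟩ := infinite_close_algebraic hξ hdeg hcard
    obtain ⟨c', hc', hlow⟩ := exists_le_norm_sub_pow_mul_algHeight_pow hξ hdeg
    have he0 := card_conjPair_pos ξ
    generalize (conjPair ξ).card = e at *
    have heR : (0 : ℝ) < e := by exact_mod_cast he0
    set t : ℝ := (n + 1 : ℝ) / e with ht
    have ht0 : 0 ≤ t := by positivity
    rw [show -t = -(t - 1) - 1 by ring] at hinf
    refine ⟨t - 1, koksmaExponent_eq_of_infinite hinf fun w' hw' => ?_, c, hc, hinf⟩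
    refine not_infinite_of_lower_bound (c := c' ^ (e : ℝ)⁻¹) (by positivity) (by linarith)
      (fun α hα h1 => ?_) hw'
    have hH : 0 < algHeight α := one_pos.trans_le (one_le_algHeight α)
    refine (Real.rpow_le_rpow hc'.le (hlow α hα h1) (by positivity)).trans_eq ?_
    rw [pow_mul_pow_rpow_inv n he0 (norm_nonneg _) hH.le, sub_add_cancel]
  · have h2 : (conjPair ξ).card ≤ 2 := Finset.card_le_two
    -- The pair has at most two elements and more than n ≥ 1, so ξ is a non-real quadratic number.
    obtain rfl : n = 1 := by omega
    have him : ξ.im ≠ 0 := by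
      intro h
      rw [conjPair, Complex.conj_eq_iff_im.mpr h, Finset.pair_eq_singleton,
        Finset.card_singleton] at hcard
      exact hcard le_rfl
    have hlow := abs_im_le_norm_sub_of_degree_one ξ
    have hinf := infinite_rational_bounded_distance ξ fun α hα =>
      (abs_pos.mpr him).trans_le (hlow α hα)
    have hinf' : {α ∈ algNumbersOfDegreeLE 1 | 0 < ‖ξ - α‖ ∧
        ‖ξ - α‖ ≤ (‖ξ‖ + 1) * algHeight α ^ (-(-1 : ℝ) - 1)}.Infinite := by
      simpa using hinf
    refine ⟨-1, koksmaExponent_eq_of_infinite hinf' fun w' hw' => ?_, ‖ξ‖ + 1, by positivity, hinf'⟩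
    refine not_infinite_of_lower_bound (abs_pos.mpr him) le_rfl (fun α hα _ => ?_) hw'
    simpa using hlow α hα
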